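/- **Notation.** For $m\ge 1$ and a partition $\lambda=(\lambda_1\ge\dots\ge\lambda_m\ge 0)$, let $\chi_\lambda^{\mathrm{Sp}(2m)}\in\mathbb Z[x_1^{\pm1},\dots,x_m^{\pm1}]$ be the irreducible character of $\mathrm{Sp}(2m)$ attached to $\lambda$, evaluated at $\mathrm{diag}(x_1,\dots,x_m,x_1^{-1},\dots,x_m^{-1})$, given by Weyl's formula as $$\chi_\lambda^{\mathrm{Sp}(2m)}=\frac{\det\bigl(x_j^{\lambda_i+m-i+1}-x_j^{-(\lambda_i+m-i+1)}\bigr)_{1\le i,j\le m}}{\det\bigl(x_j^{m-i+1}-x_j^{-(m-i+1)}\bigr)_{1\le i,j\le m}} .$$ Let $\mathrm{USp}(4)$ be the group of unitary $4\times4$ matrices preserving the form $\begin{pmatrix}0&I_2\\-I_2&0\end{pmatrix}$. For $n\in\{1,2,3,4,6\}$ put $\boldsymbol\zeta_{2n}=\mathrm{diag}(e^{\pi i/n},e^{-\pi i/n},e^{-\pi i/n},e^{\pi i/n})$, let $$J=\begin{pmatrix}0&0&0&1\\0&0&-1&0\\0&-1&0&0\\1&0&0&0\end{pmatrix},$$ and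 let $C_n\le \mathrm{USp}(4)$ be the subgroup generated by $\boldsymbol\zeta_{2n}$ and all $\mathrm{diag}(u,u,u^{-1},u^{-1})$ with $u\in\mathbb C$, $|u|=1$; let $d\gamma$ be the Haar probability measure on the compact group $C_1$. Put $\kappa_1=-2$, $\kappa_2=2$, $\kappa_3=1$, $\kappa_4=0$, $\kappa_6=-1$. For integers $z,b\ge0$ put $$\psi_1(z,b)=(-1)^b(b+1)\bigl(z+\tfrac b2+1\bigr),\qquad \psi_2(z,b)=\begin{cases}(-1)^z\,\tfrac{b+1}2,& b\text{ odd},\\(-1)^z\bigl(z+\tfrac b2+1\bigr),& b\text{ even},\end{cases}$$ and let $\psi_3,\psi_4,\psi_6$ be given by the following matrices, where the row (numbered from $0$) is the class of $z$ modulo the number of rows ($3,4,6$ respectively) and the column (numbered from $0$) is the class of $b$ modulo the number of columns ($6,4,6$ respectively): $$\psi_3:\begin{pmatrix}1&0&0&-1&0&0\\-1&1&0&1&-1&0\\0&-1&0&0&1&0\end{pmatrix},\quad \psi_4:\begin{pmatrix}1&-1&0&0\\0&1&-1&0\\-1&1&0&0\\0&-1&1&0\end{pmatrix},\quad \psi_6:\begin{pmatrix}1&-2&2&-1&0&0\\1&-1&0&1&-1&0\\0&1&-2&2&-1&0\\-1&2&-2&1&0&0\\-1&1&0&-1&1&0\\0&-1&2&-2&1&0\end{pmatrix}.$$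 **Theorem.** Let $n\in\{1,2,3,4,6\}$. Then $\psi_n(z,b)\in\mathbb Z$ for all integers $z,b\ge0$, and for every $m\ge1$ and all nonzero complex numbers $x_1,\dots,x_m$, $$\int_{C_1}\prod_{i=1}^m\det\bigl(I+x_iJ\boldsymbol\zeta_{2n}\gamma\bigr)\,d\gamma=(x_1\cdots x_m)^2\prod_{i=1}^m\bigl(x_i^2+\kappa_n+x_i^{-2}\bigr)$$ and $$\prod_{i=1}^m\bigl(x_i^2+\kappa_n+x_i^{-2}\bigr)=\sum_{b=0}^m\ \sum_{z=0}^{\lfloor (m-b)/2\rfloor}\psi_n(z,b)\,\chi^{\mathrm{Sp}(2m)}_{(2^{m-b-2z},\,1^{2z})}(x_1^{\pm1},\dots,x_m^{\pm1}),$$ where $(2^p,1^q)$ denotes the partition with $p$ parts equal to $2$ and $q$ parts equal to $1$, padded with zeros to length $m$. -/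

import Mathlib

open Polynomial in
/-- Polynomials `p k`, monic of degree `k`, with
`x ^ (k + 1) - x ^ (-(k + 1)) = (x - x⁻¹) * p k (x + x⁻¹)`. -/
noncomputable def sympPoly (R : Type*) [CommRing R] : ℕ → R[X]
  | 0 => 1
  | 1 => X
  | k + 2 => X * sympPoly R (k + 1) - sympPoly R k

open Polynomial in
theorem sympPoly_monic_natDegree (R : Type*) [CommRing R] [Nontrivial R] (k : ℕ) :
    (sympPoly R k).Monic ∧ (sympPoly R k).natDegree = k := by
  induction k using Nat.strong_induction_on with
  | _ k ih =>
    match k, ih with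
    | 0, _ => simp [sympPoly]
    | 1, _ => simp [sympPoly, monic_X]
    | k + 2, ih =>
      obtain ⟨hm, hd⟩ := ih (k + 1) (by omega)
      obtain ⟨hm0, hd0⟩ := ih k (by omega)
      have h1 : (X * sympPoly R (k + 1)).Monic := monic_X.mul hm
      have h2 : (X * sympPoly R (k + 1)).natDegree = k + 2 := by
        rw [monic_X.natDegree_mul hm, natDegree_X, hd]; omega
      have h3 : (sympPoly R k).degree < (X * sympPoly R (k + 1)).degree := by
        rw [degree_eq_natDegree h1.ne_zero, degree_eq_natDegree hm0.ne_zero, h2, hd0]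
        exact_mod_cast (by omega : k < k + 2)
      refine ⟨?_, ?_⟩
      · rw [sympPoly]; exact h1.sub_of_left h3
      · rw [sympPoly, natDegree_sub_eq_left_of_natDegree_lt, h2]
        rw [h2, hd0]; omega

theorem sympPoly_eval (R : Type*) [CommRing R] (x y : R) (hxy : x * y = 1) (k : ℕ) :
    x ^ (k + 1) - y ^ (k + 1) = (x - y) * (sympPoly R k).eval (x + y) := by
  induction k using Nat.strong_induction_on with
  | _ k ih =>
    match k, ih with
    | 0, _ => simp [sympPoly]
    | 1, _ => simp [sympPoly]; ring
    | k + 2, ih =>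
      have h1 := ih (k + 1) (by omega)
      have h0 := ih k (by omega)
      simp only [sympPoly, Polynomial.eval_sub, Polynomial.eval_mul, Polynomial.eval_X]
      have : (x - y) * ((x + y) * (sympPoly R (k + 1)).eval (x + y) - (sympPoly R k).eval (x + y))
        = (x + y) * ((x - y) * (sympPoly R (k + 1)).eval (x + y))
          - (x - y) * (sympPoly R k).eval (x + y) := by ring
      rw [this, ← h1, ← h0]
      linear_combination -(x ^ (k + 1) - y ^ (k + 1)) * hxy

open Polynomial in
theorem vandermonde_dvd_det_eval {R : Type*} [CommRing R] [Nontrivial R] {m : ℕ}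
    (p : Fin m → R[X]) (v : Fin m → R) :
    (Matrix.vandermonde v).det ∣ (Matrix.of fun i j => (p i).eval (v j)).det := by
  set P : R[X] := ∏ j, (X - C (v j)) with hP
  have hPm : P.Monic := monic_prod_of_monic _ _ fun j _ => monic_X_sub_C _
  have hPd : P.natDegree = m := by
    rw [hP, natDegree_prod_of_monic _ _ fun j _ => monic_X_sub_C _]; simp
  have hdeg : ∀ i, (p i %ₘ P).natDegree < m ∨ m = 0 := by
    intro i
    by_cases hm : m = 0
    · exact Or.inr hm
    · left
      have := natDegree_modByMonic_lt (p i) hPm (by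
        intro h; rw [h] at hPd; simp at hPd; omega)
      omega
  have key : (Matrix.of fun i j => (p i).eval (v j)) =
      (Matrix.of fun i (k : Fin m) => (p i %ₘ P).coeff k) * (Matrix.vandermonde v).transpose := by
    ext i j
    have hroot : P.eval (v j) = 0 := by
      rw [hP, eval_prod]
      exact Finset.prod_eq_zero (Finset.mem_univ j) (by simp)
    have h1 : (p i).eval (v j) = (p i %ₘ P).eval (v j) := by
      conv_lhs => rw [← modByMonic_add_div (p i) P]
      simp [hroot]
    have hlt : (p i %ₘ P).natDegree < m := by
      rcases hdeg i with h | h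
      · exact h
      · subst h; exact j.elim0
    rw [Matrix.of_apply, h1, eval_eq_sum_range' hlt, Matrix.mul_apply, Finset.sum_range]
    simp [Matrix.vandermonde_apply]
  rw [key, Matrix.det_mul, Matrix.det_transpose]
  exact dvd_mul_left _ _

/-- The ring of Laurent polynomials `ℤ[x₁^{±1}, …, x_m^{±1}]`. -/
abbrev LaurentRing (m : ℕ) : Type := AddMonoidAlgebra ℤ (Fin m → ℤ)

/-- The Laurent monomial `x_j ^ k`. -/
noncomputable def laurentVar {m : ℕ} (j : Fin m) (k : ℤ) : LaurentRing m :=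
  AddMonoidAlgebra.single (Pi.single j k) 1

/-- The alternant `det (x_j ^ {λ_i + m - i + 1} - x_j ^ {-(λ_i + m - i + 1)})`, `1 ≤ i, j ≤ m`
(the index `i` below starts at `0`). -/
noncomputable def sympAlternant {m : ℕ} (lam : Fin m → ℕ) : LaurentRing m :=
  (Matrix.of fun i j : Fin m =>
    laurentVar j ((lam i : ℤ) + m - i) - laurentVar j (-((lam i : ℤ) + m - i))).det

theorem laurentVar_mul {m : ℕ} (j : Fin m) (k l : ℤ) :
    laurentVar j k * laurentVar j l = laurentVar j (k + l) := by
  simp [laurentVar, AddMonoidAlgebra.single_mul_single, ← Pi.single_add]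

theorem laurentVar_zero {m : ℕ} (j : Fin m) : laurentVar j 0 = 1 := by
  simp [laurentVar, AddMonoidAlgebra.one_def]

theorem laurentVar_pow {m : ℕ} (j : Fin m) (k : ℤ) (n : ℕ) :
    laurentVar j k ^ n = laurentVar j (n * k) := by
  induction n with
  | zero => simp [laurentVar_zero]
  | succ n ih => rw [pow_succ, ih, laurentVar_mul]; congr 1; push_cast; ring

theorem sympAlternant_eq {m : ℕ} (lam : Fin m → ℕ) :
    sympAlternant lam = (∏ j : Fin m, (laurentVar j 1 - laurentVar j (-1))) *
      (Matrix.of fun i j : Fin m => (sympPoly (LaurentRing m) (lam i + (m - 1 - i))).eval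
        (laurentVar j 1 + laurentVar j (-1))).det := by
  rw [← Matrix.det_mul_row, sympAlternant]
  congr 1
  ext1 i j
  simp only [Matrix.of_apply]
  rw [← sympPoly_eval _ _ _ (by rw [laurentVar_mul, add_neg_cancel, laurentVar_zero]),
    laurentVar_pow, laurentVar_pow]
  have : ((lam i + (m - 1 - i) + 1 : ℕ) : ℤ) = (lam i : ℤ) + m - i := by
    have := i.isLt; omega
  rw [this]; simp

theorem laurent_add_injective (m : ℕ) :
    Function.Injective fun j : Fin m => (laurentVar j 1 + laurentVar j (-1) : LaurentRing m) := by
  intro j k h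
  by_contra hjk
  have h2 := congrArg (fun f : LaurentRing m => f.coeff (Pi.single j 1)) h
  have e2 : (Pi.single k 1 : Fin m → ℤ) ≠ Pi.single j 1 := by
    intro h; have := congrFun h j; simp [hjk] at this
  have e3 : (Pi.single k (-1) : Fin m → ℤ) ≠ Pi.single j 1 := by
    intro h; have := congrFun h j; simp [hjk] at this
  simp [laurentVar, e2, e3] at h2

theorem laurent_sub_ne_zero {m : ℕ} (j : Fin m) :
    (laurentVar j 1 - laurentVar j (-1) : LaurentRing m) ≠ 0 := by
  intro h
  have h2 := congrArg (fun f : LaurentRing m => f.coeff (Pi.single j 1)) h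
  simp [laurentVar] at h2

theorem sympAlternant_zero_eq {m : ℕ} : ∃ s : ℤˣ,
    sympAlternant (0 : Fin m → ℕ) = (∏ j : Fin m, (laurentVar j 1 - laurentVar j (-1))) *
      (((s : ℤ) : LaurentRing m) * (Matrix.vandermonde
        fun j : Fin m => (laurentVar j 1 + laurentVar j (-1) : LaurentRing m)).det) := by
  refine ⟨Equiv.Perm.sign (Fin.revPerm : Equiv.Perm (Fin m)), ?_⟩
  rw [sympAlternant_eq]
  congr 1
  rw [Matrix.det_eval_matrixOfPolynomials_eq_det_vandermonde _
    (fun i : Fin m => sympPoly (LaurentRing m) i)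
    (fun i => (sympPoly_monic_natDegree _ _).2) (fun i => (sympPoly_monic_natDegree _ _).1),
    ← Matrix.det_transpose, ← Matrix.det_permute']
  congr 1
  ext1 i j
  simp only [Matrix.transpose_apply, Matrix.of_apply, Matrix.submatrix_apply, id,
    Fin.revPerm_apply, Fin.val_rev, Pi.zero_apply, zero_add]
  congr 2
  omega

theorem sympAlternant_zero_ne_zero (m : ℕ) : sympAlternant (0 : Fin m → ℕ) ≠ 0 := by
  obtain ⟨s, hs⟩ := sympAlternant_zero_eq (m := m)
  rw [hs]
  have : IsDomain (LaurentRing m) := NoZeroDivisors.to_isDomain _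
  refine mul_ne_zero (Finset.prod_ne_zero_iff.mpr fun j _ => laurent_sub_ne_zero j)
    (mul_ne_zero ?_ (Matrix.det_vandermonde_ne_zero_iff.mpr (laurent_add_injective m)))
  exact (s.isUnit.map (Int.castRingHom (LaurentRing m))).ne_zero

/-- The alternant of `λ` is divisible by the alternant of the empty partition, in a unique way. -/
theorem existsUnique_spChar {m : ℕ} (lam : Fin m → ℕ) :
    ∃! f : LaurentRing m, f * sympAlternant (0 : Fin m → ℕ) = sympAlternant lam := by
  obtain ⟨s, hs⟩ := sympAlternant_zero_eq (m := m)
  have hd : sympAlternant (0 : Fin m → ℕ) ∣ sympAlternant lam := by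
    rw [hs, sympAlternant_eq lam]
    refine mul_dvd_mul_left _ ?_
    have hu : IsUnit ((s : ℤ) : LaurentRing m) :=
      s.isUnit.map (Int.castRingHom (LaurentRing m))
    rw [hu.mul_left_dvd]
    exact vandermonde_dvd_det_eval _ _
  obtain ⟨f, hf⟩ := hd
  refine ⟨f, by rw [hf, mul_comm], fun g hg => ?_⟩
  exact mul_right_cancel₀ (sympAlternant_zero_ne_zero m) (by simp only [hg, hf, mul_comm])

/-- The irreducible character of `Sp(2m)` attached to the partition `λ = (λ₁ ≥ ⋯ ≥ λ_m ≥ 0)`, as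
a Laurent polynomial in `x₁, …, x_m` (its values at `diag(x₁, …, x_m, x₁⁻¹, …, x_m⁻¹)`): by Weyl,
the quotient of the alternant of `λ` by the alternant of the empty partition. -/
noncomputable def spChar {m : ℕ} (lam : Fin m → ℕ) : LaurentRing m :=
  (existsUnique_spChar lam).choose

/-- The value of a Laurent polynomial at a point `x` of the torus `(ℂˣ)^m`. -/
noncomputable def laurentEval {m : ℕ} (x : Fin m → ℂˣ) : LaurentRing m →ₐ[ℤ] ℂ :=
  AddMonoidAlgebra.lift ℤ ℂ (Fin m → ℤ)
    { toFun := fun a => ∏ i, ((x i ^ (a.toAdd i) : ℂˣ) : ℂ)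
      map_one' := by simp
      map_mul' := fun a b => by simp [zpow_add, Finset.prod_mul_distrib] }

/-- The partition `(2^p, 1^q)`, padded with zeros to length `m`. -/
def twoOnePartition (m p q : ℕ) (i : Fin m) : ℕ :=
  if (i : ℕ) < p then 2 else if (i : ℕ) < p + q then 1 else 0

/-- The coefficients `ψ_n(z, b)`, `n = 1, 2, 3, 4, 6`. For `n = 3, 4, 6` the rows of the table are
indexed by the class of `z` and the columns by the class of `b`, modulo the size of the table. -/
def psiCoeff (n z b : ℕ) : ℚ :=
  match n with
  | 1 => (-1) ^ b * (b + 1) * (z + b / 2 + 1)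
  | 2 => if Odd b then (-1) ^ z * ((b + 1) / 2) else (-1) ^ z * (z + b / 2 + 1)
  | 3 => (!![ 1,  0,  0, -1,  0,  0;
             -1,  1,  0,  1, -1,  0;
              0, -1,  0,  0,  1,  0] : Matrix (Fin 3) (Fin 6) ℚ) (Fin.ofNat 3 z) (Fin.ofNat 6 b)
  | 4 => (!![ 1, -1,  0,  0;
              0,  1, -1,  0;
             -1,  1,  0,  0;
              0, -1,  1,  0] : Matrix (Fin 4) (Fin 4) ℚ) (Fin.ofNat 4 z) (Fin.ofNat 4 b)
  | 6 => (!![ 1, -2,  2, -1,  0,  0;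
              1, -1,  0,  1, -1,  0;
              0,  1, -2,  2, -1,  0;
             -1,  2, -2,  1,  0,  0;
             -1,  1,  0, -1,  1,  0;
              0, -1,  2, -2,  1,  0] : Matrix (Fin 6) (Fin 6) ℚ) (Fin.ofNat 6 z) (Fin.ofNat 6 b)
  | _ => 0

/-- The constants `κ_n`, `n = 1, 2, 3, 4, 6`. -/
def kappa (n : ℕ) : ℤ :=
  match n with
  | 1 => -2
  | 2 => 2
  | 3 => 1
  | 4 => 0
  | 6 => -1
  | _ => 0

/-- The matrix of the symplectic form on `ℂ⁴`. -/
def sympForm4 : Matrix (Fin 4) (Fin 4) ℂ :=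
  !![0, 0, 1, 0;
     0, 0, 0, 1;
     -1, 0, 0, 0;
     0, -1, 0, 0]

/-- The group `USp(4)` of unitary `4 × 4` matrices that preserve the symplectic form. -/
def USp4 : Subgroup (Matrix.unitaryGroup (Fin 4) ℂ) where
  carrier := {g | (g : Matrix (Fin 4) (Fin 4) ℂ).transpose * sympForm4 *
    (g : Matrix (Fin 4) (Fin 4) ℂ) = sympForm4}
  mul_mem' := by
    intro a b ha hb
    simp only [Set.mem_ofPred_eq, Submonoid.coe_mul, Matrix.transpose_mul] at *
    calc _ = (b : Matrix (Fin 4) (Fin 4) ℂ).transpose *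
          ((a : Matrix (Fin 4) (Fin 4) ℂ).transpose * sympForm4 * a) * b := by
            simp only [Matrix.mul_assoc]
      _ = _ := by rw [ha, hb]
  one_mem' := by simp
  inv_mem' := by
    intro a ha
    simp only [Set.mem_ofPred_eq] at *
    have h1 : (a : Matrix (Fin 4) (Fin 4) ℂ) * ((a⁻¹ : Matrix.unitaryGroup (Fin 4) ℂ) :
        Matrix (Fin 4) (Fin 4) ℂ) = 1 := by
      rw [← Submonoid.coe_mul, mul_inv_cancel, Submonoid.coe_one]
    set c := ((a⁻¹ : Matrix.unitaryGroup (Fin 4) ℂ) : Matrix (Fin 4) (Fin 4) ℂ)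
    have h2 : c.transpose * (a : Matrix (Fin 4) (Fin 4) ℂ).transpose = 1 := by
      rw [← Matrix.transpose_mul, h1, Matrix.transpose_one]
    calc c.transpose * sympForm4 * c
        = c.transpose * ((a : Matrix (Fin 4) (Fin 4) ℂ).transpose * sympForm4 * a) * c := by rw [ha]
      _ = (c.transpose * (a : Matrix (Fin 4) (Fin 4) ℂ).transpose) * sympForm4 * (a * c) := by
          simp only [Matrix.mul_assoc]
      _ = sympForm4 := by rw [h1, h2]; simp

/-- The underlying matrix of an element of `USp(4)`. -/
def USp4.toMatrix (g : USp4) : Matrix (Fin 4) (Fin 4) ℂ :=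
  ((g : Matrix.unitaryGroup (Fin 4) ℂ) : Matrix (Fin 4) (Fin 4) ℂ)

/-- The matrix `diag(u, v, u⁻¹, v⁻¹)`, for `u, v ∈ U(1)`, as an element of `USp(4)`. -/
noncomputable def torus4 (u v : Circle) : USp4 :=
  ⟨⟨Matrix.diagonal ![(u : ℂ), v, (u⁻¹ : Circle), (v⁻¹ : Circle)], by
      rw [Matrix.mem_unitaryGroup_iff, Matrix.star_eq_conjTranspose,
        Matrix.diagonal_conjTranspose, Matrix.diagonal_mul_diagonal, ← Matrix.diagonal_one]
      congr 1
      ext i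
      fin_cases i <;> simp [← Circle.coe_inv_eq_conj]⟩, by
    change (Matrix.diagonal _).transpose * sympForm4 * Matrix.diagonal _ = sympForm4
    ext i j
    fin_cases i <;> fin_cases j <;> simp [sympForm4, Matrix.mul_apply, Fin.sum_univ_four]⟩

/-- The embedding `u ↦ diag(u, u, u⁻¹, u⁻¹)` of `U(1)` into `USp(4)`. -/
noncomputable def u1Embed (u : Circle) : USp4 := torus4 u u

/-- `ζ_{2n} = diag(e^{πi/n}, e^{-πi/n}) ∈ SU(2)`, embedded into `USp(4)` by `A ↦ diag(A, Ā)`. -/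
noncomputable def zeta (n : ℕ) : USp4 := torus4 (Circle.exp (Real.pi / n)) (Circle.exp (-(Real.pi / n)))

/-- The element `J` of `USp(4)`. -/
def matJ : USp4 :=
  ⟨⟨!![0, 0, 0, 1;
       0, 0, -1, 0;
       0, -1, 0, 0;
       1, 0, 0, 0], by
      rw [Matrix.mem_unitaryGroup_iff]
      ext i j
      fin_cases i <;> fin_cases j <;>
        simp [Matrix.mul_apply, Fin.sum_univ_four, Matrix.star_apply]⟩, by
    change Matrix.transpose _ * sympForm4 * _ = sympForm4
    ext i j
    fin_cases i <;> fin_cases j <;> simp [sympForm4, Matrix.mul_apply, Fin.sum_univ_four]⟩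

/-- The Sato–Tate group `C_n`, generated by `U(1)` and `ζ_{2n}`. -/
def groupC (n : ℕ) : Subgroup USp4 :=
  Subgroup.closure (Set.range u1Embed ∪ {zeta n})

theorem continuous_u1Embed : Continuous u1Embed := by
  refine Continuous.subtype_mk (Continuous.subtype_mk ?_ _) _
  refine Continuous.matrix_diagonal ?_
  have hc : Continuous fun u : Circle => (u : ℂ) := by fun_prop
  refine continuous_pi fun i => ?_
  fin_cases i
  · exact hc
  · exact hc
  · exact hc.comp continuous_inv
  · exact hc.comp continuous_inv

theorem torus4_mul (u v u' v' : Circle) :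
    torus4 u v * torus4 u' v' = torus4 (u * u') (v * v') := by
  apply Subtype.ext
  apply Subtype.ext
  change Matrix.diagonal _ * Matrix.diagonal _ = Matrix.diagonal _
  rw [Matrix.diagonal_mul_diagonal]
  congr 1
  ext i
  fin_cases i <;> simp [mul_comm]

/-- The embedding of `U(1)` into `USp(4)` as a group homomorphism. -/
noncomputable def u1Hom : Circle →* USp4 :=
  MonoidHom.mk' u1Embed fun u v => (torus4_mul u u v v).symm

theorem coe_groupC_one : (groupC 1 : Set USp4) = Set.range u1Embed := by
  have hz : zeta 1 ∈ Set.range u1Embed := by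
    refine ⟨Circle.exp Real.pi, ?_⟩
    have : Circle.exp (-Real.pi) = Circle.exp Real.pi := by
      apply Circle.ext
      simp [Circle.coe_exp]
    simp [u1Embed, zeta, this]
  have h : groupC 1 = u1Hom.range := by
    rw [groupC, Set.union_eq_self_of_subset_right (Set.singleton_subset_iff.mpr hz)]
    exact Subgroup.closure_eq u1Hom.range
  rw [h]
  rfl

instance compactSpace_groupC_one : CompactSpace (groupC 1) := by
  have h : IsCompact (groupC 1 : Set USp4) := by
    rw [coe_groupC_one]
    exact isCompact_range continuous_u1Embed
  exact isCompact_iff_compactSpace.mp h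

noncomputable instance measurableSpace_groupC (n : ℕ) : MeasurableSpace (groupC n) := borel _

instance borelSpace_groupC (n : ℕ) : BorelSpace (groupC n) := ⟨rfl⟩

/-- The Haar probability measure on `C_1`. -/
noncomputable def haarC1 : MeasureTheory.Measure (groupC 1) :=
  MeasureTheory.Measure.haarMeasure ⊤

/-! The integrand is constant: `det (1 + x J diag(u, v, u⁻¹, v⁻¹))` depends only on `u / v`, which
multiplication by an element of `C_1` does not change. For `ζ_{2n}` the ratios `u / v` and `v / u`
are `e^{±2πi/n}`, with sum `-κ_n`.

For the expansion put `y_i = x_i + x_i⁻¹`, so that `x_i² + κ + x_i⁻² = f(y_i)` with `f = X² + κ -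
2`. Consider the determinant of size `m + 2` whose rows are the two coefficients of the remainder
modulo `f` and the `m` evaluations at the `y_i`, applied to a monic basis of the polynomials of
degree at most `m + 1`. It does not depend on the basis. For `1, X, f, fX, …` it equals `∏ f(y_i)`
times the Vandermonde determinant. For the basis `sympPoly`, Laplace expansion along the first two
rows gives the minors with two columns deleted; by Weyl's formula these are, up to a common factor,
alternants of partitions `(2^p, 1^q)` (`prod_quadratic_mul_vandermonde`, `skip_laplaceIndex_eq`).

Since `f` is even, `sympPoly k` leaves a constant modulo `f` for even `k` and a multiple of `X` for
odd `k`, so only pairs of columns of opposite parity survive. The remainders follow a Lucas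
recurrence with characteristic roots `e^{±2πi/n}` when `κ = κ_n`: it is linear up to sign for `n =
1, 2` and periodic for `n = 3, 4, 6`. This yields the formulas and tables for `ψ_n`, and its
integrality. -/

/-! ### A dual Cauchy identity for a quadratic polynomial -/

open Polynomial in
/-- For linear functionals `L i`, the determinant of `L i (p j)` does not depend on the choice of
the monic basis `p`. -/
theorem det_functional_eq_det_functional_X_pow {R : Type*} [CommRing R] {n : ℕ}
    (L : Fin n → R[X] →ₗ[R] R) (p : Fin n → R[X])
    (hd : ∀ i, (p i).natDegree = i) (hm : ∀ i, (p i).Monic) :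
    (Matrix.of fun i j => L i (p j)).det = (Matrix.of fun i j : Fin n => L i (X ^ (j : ℕ))).det := by
  -- The change of basis from the powers of `X` is unitriangular.
  have h : (Matrix.of fun i j => L i (p j)) =
      (Matrix.of fun i j : Fin n => L i (X ^ (j : ℕ))) *
        Matrix.of fun i j : Fin n => (p j).coeff i := by
    ext i j
    have hlt : (p j).natDegree < n := by rw [hd]; exact j.isLt
    rw [Matrix.of_apply, Matrix.mul_apply]
    conv_lhs => rw [(p j).as_sum_range' n hlt]
    rw [map_sum, Finset.sum_range]
    refine Finset.sum_congr rfl fun k _ => ?_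
    rw [← C_mul_X_pow_eq_monomial, ← smul_eq_C_mul, map_smul, smul_eq_mul, mul_comm]
    rfl
  rw [h, Matrix.det_mul, Matrix.det_matrixOfPolynomials p hd hm, mul_one]

open Polynomial in
/-- The `k`-th coefficient of the remainder modulo `f`. -/
noncomputable def remCoeff {R : Type*} [CommRing R] (f : R[X]) (k : ℕ) : R[X] →ₗ[R] R :=
  lcoeff R k ∘ₗ modByMonicHom f

open Polynomial in
theorem remCoeff_self_mul {R : Type*} [CommRing R] {f : R[X]} (hf : f.Monic) (k : ℕ) (g : R[X]) :
    remCoeff f k (f * g) = 0 := by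
  simp [remCoeff, modByMonicHom, self_mul_modByMonic hf]

open Polynomial in
theorem remCoeff_of_natDegree_lt {R : Type*} [CommRing R] {f : R[X]} (hf : f.Monic) (k : ℕ)
    {g : R[X]} (hg : g.natDegree < f.natDegree) : remCoeff f k g = g.coeff k := by
  simp only [remCoeff, modByMonicHom, LinearMap.comp_apply, LinearMap.coe_mk, AddHom.coe_mk,
    lcoeff_apply]
  rcases subsingleton_or_nontrivial R with h | h
  · exact Subsingleton.elim _ _
  · rw [(modByMonic_eq_self_iff hf).2 (degree_lt_degree hg)]

open Polynomial in
/-- The basis `1, X, f, f X, f X², …`. -/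
noncomputable def quadraticBasis {R : Type*} [CommRing R] (f : R[X]) : ℕ → R[X]
  | 0 => 1
  | 1 => X
  | k + 2 => f * X ^ k

open Polynomial in
/-- A dual Cauchy identity for a monic quadratic polynomial `f` and a basis of monic polynomials. -/
theorem prod_quadratic_mul_vandermonde {R : Type*} [CommRing R] [Nontrivial R] {m : ℕ}
    (f : R[X]) (hf : f.Monic) (hf2 : f.natDegree = 2) (p : ℕ → R[X])
    (hd : ∀ i, (p i).natDegree = i) (hm : ∀ i, (p i).Monic) (y : Fin m → R) :
    (∏ i, f.eval (y i)) * (Matrix.vandermonde y).det =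
      ∑ k : Fin (m + 2), ∑ l : Fin (m + 1), (-1) ^ (k + l : ℕ) * remCoeff f 0 (p k) *
        remCoeff f 1 (p (k.succAbove l)) *
        (Matrix.of fun i j => (p (k.succAbove (l.succAbove j))).eval (y i)).det := by
  set L : Fin (m + 2) → R[X] →ₗ[R] R :=
    Fin.cons (remCoeff f 0) (Fin.cons (remCoeff f 1) fun i => leval (y i)) with hL
  have expand : ∀ r : ℕ → R[X], (Matrix.of fun i j : Fin (m + 2) => L i (r j)).det =
      ∑ k : Fin (m + 2), ∑ l : Fin (m + 1), (-1) ^ (k + l : ℕ) * remCoeff f 0 (r k) *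
        remCoeff f 1 (r (k.succAbove l)) *
        (Matrix.of fun i j => (r (k.succAbove (l.succAbove j))).eval (y i)).det := by
    intro r
    rw [Matrix.det_succ_row_zero]
    refine Finset.sum_congr rfl fun k _ => ?_
    rw [Matrix.det_succ_row_zero, Finset.mul_sum]
    refine Finset.sum_congr rfl fun l _ => ?_
    have : (((Matrix.of fun i j : Fin (m + 2) => L i (r j)).submatrix Fin.succ
        k.succAbove).submatrix Fin.succ l.succAbove) =
        Matrix.of fun i j => (r (k.succAbove (l.succAbove j))).eval (y i) := by
      ext i j; simp [hL]
    rw [this]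
    simp only [Matrix.submatrix_apply, Matrix.of_apply, hL, Fin.cons_zero, Fin.cons_succ]
    ring
  have hq : ∀ k, (quadraticBasis f k).Monic ∧ (quadraticBasis f k).natDegree = k := by
    intro k
    match k with
    | 0 => simp [quadraticBasis]
    | 1 => simp [quadraticBasis, monic_X]
    | k + 2 =>
      refine ⟨hf.mul (monic_X_pow k), ?_⟩
      rw [quadraticBasis, hf.natDegree_mul (monic_X_pow k), hf2, natDegree_X_pow, add_comm]
  have h0 : ∀ k, remCoeff f 0 (quadraticBasis f k) = if k = 0 then 1 else 0 := by
    intro k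
    match k with
    | 0 => rw [remCoeff_of_natDegree_lt hf] <;> simp [quadraticBasis, hf2]
    | 1 => rw [remCoeff_of_natDegree_lt hf] <;> simp [quadraticBasis, hf2]
    | k + 2 => simp [quadraticBasis, remCoeff_self_mul hf]
  have h1 : ∀ k, remCoeff f 1 (quadraticBasis f k) = if k = 1 then 1 else 0 := by
    intro k
    match k with
    | 0 => rw [remCoeff_of_natDegree_lt hf] <;> simp [quadraticBasis, hf2, coeff_one]
    | 1 => rw [remCoeff_of_natDegree_lt hf] <;> simp [quadraticBasis, hf2]
    | k + 2 => simp [quadraticBasis, remCoeff_self_mul hf]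
  -- In `quadraticBasis` the two remainder rows are the first two unit vectors, so only columns `0`
  -- and `1` are ever deleted, that is `k = l = 0`.
  rw [← expand p, det_functional_eq_det_functional_X_pow L (fun j => p j) (fun j => hd j)
    (fun j => hm j), ← det_functional_eq_det_functional_X_pow L (fun j => quadraticBasis f j)
    (fun j => (hq j).2) (fun j => (hq j).1), expand, Finset.sum_eq_single 0, Finset.sum_eq_single 0]
  · have hdet : (Matrix.of fun i j : Fin m => (quadraticBasis f
        ((0 : Fin (m + 2)).succAbove ((0 : Fin (m + 1)).succAbove j))).eval (y i)).det =
        (∏ i, f.eval (y i)) * (Matrix.vandermonde y).det := by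
      rw [← Matrix.det_mul_column]
      congr 1
      ext i j
      simp [quadraticBasis, Matrix.vandermonde_apply]
    rw [h0, h1, hdet]
    simp
  · intro l _ hl
    have : ((Fin.succAbove (0 : Fin (m + 2)) l : Fin (m + 2)) : ℕ) ≠ 1 := by
      rw [Fin.succAbove_zero, Fin.val_succ]
      exact fun h => hl (Fin.ext (Nat.succ.inj h))
    rw [h1, if_neg this]; simp
  · simp
  · intro k _ hk
    have : (k : ℕ) ≠ 0 := fun h => hk (Fin.ext h)
    simp [h0, this]
  · simp

/-! ### Remainders of `sympPoly` modulo `f` -/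

/-- The sequence `1, a, …` with recurrence `u (j + 2) = -κ u (j + 1) - u j`. -/
def lucasSeq (κ a : ℤ) : ℕ → ℤ
  | 0 => 1
  | 1 => a
  | j + 2 => -κ * lucasSeq κ a (j + 1) - lucasSeq κ a j

section Remainder

open Polynomial

variable (R : Type*) [CommRing R] (κ : ℤ)

/-- The quadratic polynomial `f` with `f (x + x⁻¹) = x ^ 2 + κ + x ^ (-2)`. -/
noncomputable def kappaPoly : R[X] := X ^ 2 + C ((κ - 2 : ℤ) : R)

theorem kappaPoly_monic : (kappaPoly R κ).Monic := monic_X_pow_add_C _ two_ne_zero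

theorem kappaPoly_natDegree [Nontrivial R] : (kappaPoly R κ).natDegree = 2 := natDegree_X_pow_add_C

/-- Multiplication by `x² + x⁻² = f - κ` sends `sympPoly (k + 2)` to the sum of its neighbours at
distance two. Modulo `f` this is the Lucas recurrence within each parity class. -/
theorem sympPoly_add_four (k : ℕ) : sympPoly R (k + 4) =
    kappaPoly R κ * sympPoly R (k + 2) - (κ : R) • sympPoly R (k + 2) - sympPoly R k := by
  rw [show sympPoly R (k + 4) = X * sympPoly R (k + 3) - sympPoly R (k + 2) from rfl,
    show sympPoly R (k + 3) = X * sympPoly R (k + 2) - sympPoly R (k + 1) from rfl, smul_eq_C_mul,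
    show sympPoly R (k + 2) = X * sympPoly R (k + 1) - sympPoly R k from rfl, kappaPoly]
  simp only [Int.cast_sub, map_sub, Int.cast_ofNat, map_ofNat]
  ring

variable [Nontrivial R]

/-- The seeds are the remainders of `1` and of `X² - 1 = f + (1 - κ)`. -/
theorem remCoeff_sympPoly_even (j : ℕ) :
    remCoeff (kappaPoly R κ) 0 (sympPoly R (2 * j)) = (lucasSeq κ (1 - κ) j : R) ∧
      remCoeff (kappaPoly R κ) 1 (sympPoly R (2 * j)) = 0 := by
  have hf := kappaPoly_monic R κ
  have hf2 := kappaPoly_natDegree R κ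
  have h1 : ∀ i, remCoeff (kappaPoly R κ) i 1 = if i = 0 then 1 else 0 := fun i => by
    rw [remCoeff_of_natDegree_lt hf] <;> simp [hf2, coeff_one]
  induction j using Nat.twoStepInduction with
  | zero => simp [sympPoly, h1, lucasSeq]
  | one =>
    have : sympPoly R (2 * 1) = kappaPoly R κ * 1 + ((1 - κ : ℤ) : R) • 1 := by
      simp only [sympPoly, kappaPoly, smul_eq_C_mul, Int.cast_sub, map_sub, Int.cast_ofNat,
        map_ofNat, Int.cast_one, map_one]
      ring
    rw [this]
    simp only [map_add, map_smul, remCoeff_self_mul hf, h1, lucasSeq]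
    simp
  | more j ih0 ih1 =>
    rw [show 2 * (j + 2) = 2 * j + 4 by ring, sympPoly_add_four R κ]
    rw [show 2 * (j + 1) = 2 * j + 2 by ring] at ih1
    simp [remCoeff_self_mul hf, ih0, ih1, lucasSeq]

/-- The seeds are the remainders of `X` and of `X³ - 2X = f X - κ X`. -/
theorem remCoeff_sympPoly_odd (j : ℕ) :
    remCoeff (kappaPoly R κ) 0 (sympPoly R (2 * j + 1)) = 0 ∧
      remCoeff (kappaPoly R κ) 1 (sympPoly R (2 * j + 1)) = (lucasSeq κ (-κ) j : R) := by
  have hf := kappaPoly_monic R κ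
  have hf2 := kappaPoly_natDegree R κ
  have h1 : ∀ i, remCoeff (kappaPoly R κ) i X = if i = 1 then 1 else 0 := fun i => by
    rw [remCoeff_of_natDegree_lt hf] <;> simp [hf2, coeff_X, eq_comm]
  induction j using Nat.twoStepInduction with
  | zero => simp [sympPoly, h1, lucasSeq]
  | one =>
    have : sympPoly R (2 * 1 + 1) = kappaPoly R κ * X + ((-κ : ℤ) : R) • X := by
      simp only [sympPoly, kappaPoly, smul_eq_C_mul, Int.cast_sub, map_sub, Int.cast_ofNat,
        map_ofNat, Int.cast_neg, map_neg]
      ring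
    rw [this]
    simp only [map_add, map_smul, remCoeff_self_mul hf, h1, lucasSeq]
    simp
  | more j ih0 ih1 =>
    rw [show 2 * (j + 2) + 1 = 2 * j + 1 + 4 by ring, sympPoly_add_four R κ]
    rw [show 2 * (j + 1) + 1 = 2 * j + 1 + 2 by ring] at ih1
    simp [remCoeff_self_mul hf, ih0, ih1, lucasSeq]

end Remainder
-- Identification of `ψ_n` with products of Lucas sequences
/-- The coefficients of the expansion into symplectic characters, for arbitrary `κ`. -/
def rectCoeff (κ : ℤ) (z b : ℕ) : ℤ :=
  if Even b then lucasSeq κ (1 - κ) (b / 2) * lucasSeq κ (-κ) (b / 2 + z)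
  else -(lucasSeq κ (-κ) (b / 2) * lucasSeq κ (1 - κ) (b / 2 + z + 1))

/-- A solution of the recurrence is fixed by two consecutive values, so quasi-periodicity need only
be checked at `j = 0, 1`. -/
theorem lucasSeq_add (κ a : ℤ) (d : ℕ) (s : ℤ) (h0 : lucasSeq κ a d = s)
    (h1 : lucasSeq κ a (d + 1) = s * a) (j : ℕ) :
    lucasSeq κ a (j + d) = s * lucasSeq κ a j := by
  induction j using Nat.twoStepInduction with
  | zero => simp [h0, lucasSeq]
  | one => rw [add_comm, h1, lucasSeq]
  | more j ih0 ih1 =>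
    rw [show j + 2 + d = j + d + 2 by ring, lucasSeq, lucasSeq,
      show j + d + 1 = j + 1 + d by ring, ih0, ih1]
    ring

theorem lucasSeq_neg_two (a : ℤ) (j : ℕ) : lucasSeq (-2) a j = 1 + (a - 1) * j := by
  induction j using Nat.twoStepInduction with
  | zero => simp [lucasSeq]
  | one => simp [lucasSeq]
  | more j ih0 ih1 => rw [lucasSeq, ih0, ih1]; push_cast; ring

theorem lucasSeq_two (a : ℤ) (j : ℕ) : lucasSeq 2 a j = (-1) ^ j * (1 - (a + 1) * j) := by
  induction j using Nat.twoStepInduction with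
  | zero => simp [lucasSeq]
  | one => simp [lucasSeq]
  | more j ih0 ih1 => rw [lucasSeq, ih0, ih1]; push_cast; ring

/-- A periodicity reduction: if both Lucas sequences are multiplied by `s = ±1` under translation by
`d`, then `rectCoeff` is multiplied by `s` under translation of `z` by `d` and is invariant under
translation of `b` by `2 * d`. -/
theorem rectCoeff_periodic (κ : ℤ) (d : ℕ) (s : ℤ) (hs : s * s = 1)
    (he : ∀ j, lucasSeq κ (1 - κ) (j + d) = s * lucasSeq κ (1 - κ) j)
    (ho : ∀ j, lucasSeq κ (-κ) (j + d) = s * lucasSeq κ (-κ) j) (z b : ℕ) :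
    rectCoeff κ (z + d) b = s * rectCoeff κ z b ∧ rectCoeff κ z (b + 2 * d) = rectCoeff κ z b := by
  constructor
  · rw [rectCoeff, rectCoeff, ← add_assoc, ho, add_right_comm _ d, he]
    split_ifs <;> ring
  · have h1 : (b + 2 * d) / 2 = b / 2 + d := by omega
    have h2 : Even (b + 2 * d) ↔ Even b := by simp [Nat.even_add]
    rw [rectCoeff, rectCoeff, h1, add_right_comm _ d z, add_right_comm _ d 1]
    simp only [h2, he, ho]
    split_ifs
    · linear_combination lucasSeq κ (1 - κ) (b / 2) * lucasSeq κ (-κ) (b / 2 + z) * hs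
    · linear_combination -lucasSeq κ (-κ) (b / 2) * lucasSeq κ (1 - κ) (b / 2 + z + 1) * hs

theorem rectCoeff_mod (κ : ℤ) (r c : ℕ) (hr : ∀ z b, rectCoeff κ (z + r) b = rectCoeff κ z b)
    (hc : ∀ z b, rectCoeff κ z (b + c) = rectCoeff κ z b) (z b : ℕ) :
    rectCoeff κ z b = rectCoeff κ (z % r) (b % c) := by
  have h1 : ∀ b, Function.Periodic (fun z => rectCoeff κ z b) r := fun b z => hr z b
  have h2 : ∀ z, Function.Periodic (fun b => rectCoeff κ z b) c := fun z b => hc z b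
  rw [(h1 _).map_mod_nat z, (h2 _).map_mod_nat b]

theorem psiCoeff_one (z b : ℕ) : psiCoeff 1 z b = (rectCoeff (-2) z b : ℚ) := by
  rw [psiCoeff, rectCoeff]
  rcases Nat.even_or_odd' b with ⟨c, rfl | rfl⟩
  · rw [if_pos (even_two_mul c), Nat.mul_div_cancel_left c two_pos, lucasSeq_neg_two,
      lucasSeq_neg_two, pow_mul]
    push_cast; norm_num; ring
  · rw [if_neg (by simp), show (2 * c + 1) / 2 = c by omega, lucasSeq_neg_two,
      lucasSeq_neg_two, pow_succ, pow_mul]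
    push_cast; norm_num; ring

theorem psiCoeff_two (z b : ℕ) : psiCoeff 2 z b = (rectCoeff 2 z b : ℚ) := by
  have hsq : ∀ c : ℕ, ((-1 : ℚ) ^ c) * (-1) ^ c = 1 := fun c => by
    rw [← mul_pow]; norm_num
  rw [psiCoeff, rectCoeff]
  rcases Nat.even_or_odd' b with ⟨c, rfl | rfl⟩
  · rw [if_pos (even_two_mul c), if_neg (by simp : ¬Odd (2 * c)), Nat.mul_div_cancel_left c two_pos,
      lucasSeq_two, lucasSeq_two]
    push_cast
    linear_combination -((-1) ^ z * ((z : ℚ) + c + 1)) * hsq c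
  · rw [if_neg (by simp : ¬Even (2 * c + 1)), if_pos (odd_two_mul_add_one c), show (2 * c + 1) / 2 = c by omega,
      lucasSeq_two, lucasSeq_two]
    push_cast
    linear_combination -((-1) ^ z * ((c : ℚ) + 1)) * hsq c

theorem psiCoeff_three (z b : ℕ) : psiCoeff 3 z b = (rectCoeff 1 z b : ℚ) := by
  have hp := rectCoeff_periodic 1 3 1 rfl (lucasSeq_add _ _ _ _ rfl rfl)
    (lucasSeq_add _ _ _ _ rfl rfl)
  rw [rectCoeff_mod 1 3 6 (fun z b => by rw [(hp z b).1, one_mul]) (fun z b => (hp z b).2)]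
  simp only [psiCoeff]
  -- The residues `z % 3` and `b % 6` are the values of the table indices; generalizing these leaves
  -- a check of the 18 entries.
  change _ = ((rectCoeff _ (Fin.ofNat 3 z : Fin 3) (Fin.ofNat 6 b : Fin 6) : ℤ) : ℚ)
  generalize Fin.ofNat 3 z = i
  generalize Fin.ofNat 6 b = j
  fin_cases i <;> fin_cases j <;> simp [rectCoeff, lucasSeq, Nat.even_iff]

theorem psiCoeff_four (z b : ℕ) : psiCoeff 4 z b = (rectCoeff 0 z b : ℚ) := by
  have hp := rectCoeff_periodic 0 2 (-1) rfl (lucasSeq_add _ _ _ _ rfl rfl)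
    (lucasSeq_add _ _ _ _ rfl rfl)
  -- Translation of `z` by `2` changes the sign, hence four rows; the same happens below for `κ =
  -- -1` with `3` and six rows.
  rw [rectCoeff_mod 0 4 4 (fun z b => by
    rw [show z + 4 = z + 2 + 2 from rfl, (hp _ b).1, (hp _ b).1]; ring) (fun z b => (hp z b).2)]
  simp only [psiCoeff]
  change _ = ((rectCoeff _ (Fin.ofNat 4 z : Fin 4) (Fin.ofNat 4 b : Fin 4) : ℤ) : ℚ)
  generalize Fin.ofNat 4 z = i
  generalize Fin.ofNat 4 b = j
  fin_cases i <;> fin_cases j <;> simp [rectCoeff, lucasSeq, Nat.even_iff]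

theorem psiCoeff_six (z b : ℕ) : psiCoeff 6 z b = (rectCoeff (-1) z b : ℚ) := by
  have hp := rectCoeff_periodic (-1) 3 (-1) rfl (lucasSeq_add _ _ _ _ rfl rfl)
    (lucasSeq_add _ _ _ _ rfl rfl)
  rw [rectCoeff_mod (-1) 6 6 (fun z b => by
    rw [show z + 6 = z + 3 + 3 from rfl, (hp _ b).1, (hp _ b).1]; ring) (fun z b => (hp z b).2)]
  simp only [psiCoeff]
  change _ = ((rectCoeff _ (Fin.ofNat 6 z : Fin 6) (Fin.ofNat 6 b : Fin 6) : ℤ) : ℚ)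
  generalize Fin.ofNat 6 z = i
  generalize Fin.ofNat 6 b = j
  fin_cases i <;> fin_cases j <;> simp [rectCoeff, lucasSeq, Nat.even_iff]

theorem psiCoeff_eq_rectCoeff {n : ℕ} (hn : n ∈ ({1, 2, 3, 4, 6} : Finset ℕ)) (z b : ℕ) :
    psiCoeff n z b = (rectCoeff (kappa n) z b : ℚ) := by
  simp only [Finset.mem_insert, Finset.mem_singleton] at hn
  rcases hn with rfl | rfl | rfl | rfl | rfl
  exacts [psiCoeff_one z b, psiCoeff_two z b, psiCoeff_three z b, psiCoeff_four z b,
    psiCoeff_six z b]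

/-! ### The integral over `C_1` -/

theorem two_mul_cos_two_pi_div {n : ℕ} (hn : n ∈ ({1, 2, 3, 4, 6} : Finset ℕ)) :
    2 * Real.cos (2 * Real.pi / n) = -(kappa n : ℝ) := by
  simp only [Finset.mem_insert, Finset.mem_singleton] at hn
  rcases hn with rfl | rfl | rfl | rfl | rfl
  · simp [kappa]
  · simp [kappa]
  · rw [show 2 * Real.pi / (3 : ℕ) = Real.pi - Real.pi / 3 by push_cast; ring, Real.cos_pi_sub,
      Real.cos_pi_div_three]
    norm_num [kappa]
  · rw [show 2 * Real.pi / (4 : ℕ) = Real.pi / 2 by push_cast; ring, Real.cos_pi_div_two]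
    norm_num [kappa]
  · rw [show 2 * Real.pi / (6 : ℕ) = Real.pi / 3 by push_cast; ring, Real.cos_pi_div_three]
    norm_num [kappa]

/-- The product is antidiagonal, so it exchanges coordinates in the pairs `{0, 3}` and `{1, 2}`, and
each pair contributes a `2 × 2` determinant. -/
theorem det_one_add_smul_matJ_mul_torus4 (x : ℂ) (u v : Circle) :
    (1 + x • USp4.toMatrix (matJ * torus4 u v)).det =
      (1 - x ^ 2 * (u * (v⁻¹ : Circle))) * (1 - x ^ 2 * (v * (u⁻¹ : Circle))) := by
  have h : USp4.toMatrix (matJ * torus4 u v) =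
      !![0, 0, 0, ((v⁻¹ : Circle) : ℂ); 0, 0, -((u⁻¹ : Circle) : ℂ), 0; 0, -(v : ℂ), 0, 0;
        (u : ℂ), 0, 0, 0] := by
    change (!![0, 0, 0, 1; 0, 0, -1, 0; 0, -1, 0, 0; 1, 0, 0, 0] : Matrix (Fin 4) (Fin 4) ℂ) *
      Matrix.diagonal _ = _
    ext i j
    fin_cases i <;> fin_cases j <;> simp [Matrix.mul_diagonal]
  rw [h]
  simp [Matrix.det_succ_row_zero, Fin.sum_univ_succ, Matrix.one_apply, Fin.succAbove]
  ring

/-- An element of `C_1` multiplies both torus coordinates by the same `u`, which cancels in their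
ratios (`e1`, `e2`). -/
theorem det_one_add_smul_matJ_mul_zeta {n : ℕ} (hn : n ∈ ({1, 2, 3, 4, 6} : Finset ℕ)) (x : ℂˣ)
    (γ : groupC 1) :
    (1 + (x : ℂ) • USp4.toMatrix (matJ * zeta n * (γ : USp4))).det =
      (x : ℂ) ^ 2 * ((x : ℂ) ^ 2 + (kappa n : ℂ) + (x : ℂ) ^ (-2 : ℤ)) := by
  obtain ⟨u, hu⟩ : (γ : USp4) ∈ Set.range u1Embed := by
    rw [← coe_groupC_one]; exact γ.2
  have hx : (x : ℂ) ≠ 0 := x.ne_zero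
  set θ : ℝ := Real.pi / n with hθ
  have e1 : Circle.exp θ * u * (Circle.exp (-θ) * u)⁻¹ = Circle.exp (2 * θ) := by
    rw [mul_inv, Circle.exp_neg, inv_inv, two_mul, Circle.exp_add, mul_mul_mul_comm]; simp
  have e2 : Circle.exp (-θ) * u * (Circle.exp θ * u)⁻¹ = Circle.exp (-(2 * θ)) := by
    rw [Circle.exp_neg (2 * θ), ← e1]; simp [mul_comm]
  have e3 : (Circle.exp (2 * θ) : ℂ) + Circle.exp (-(2 * θ)) = -(kappa n : ℂ) := by
    rw [Circle.coe_exp, Circle.coe_exp]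
    have := congrArg (fun r : ℝ => (r : ℂ)) (two_mul_cos_two_pi_div hn)
    simp only [Complex.ofReal_mul, Complex.ofReal_cos, Complex.ofReal_neg,
      Complex.ofReal_intCast, Complex.ofReal_ofNat] at this
    rw [← this, Complex.two_cos, show 2 * Real.pi / (n : ℝ) = 2 * θ by rw [hθ]; ring]
    push_cast; ring_nf
  have e4 : (Circle.exp (2 * θ) : ℂ) * Circle.exp (-(2 * θ)) = 1 := by
    rw [← Circle.coe_mul, ← Circle.exp_add]; simp
  rw [← hu, zeta, u1Embed, mul_assoc, torus4_mul, det_one_add_smul_matJ_mul_torus4,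
    ← Circle.coe_mul, ← Circle.coe_mul, e1, e2, zpow_neg]
  have : (x : ℂ) ^ 2 * ((x : ℂ) ^ 2 + (kappa n : ℂ) + ((x : ℂ) ^ (2 : ℤ))⁻¹) =
      (x : ℂ) ^ 4 + kappa n * (x : ℂ) ^ 2 + 1 := by
    rw [show ((x : ℂ) ^ (2 : ℤ)) = (x : ℂ) ^ 2 from zpow_ofNat _ 2]
    field_simp
  rw [this]
  linear_combination (x : ℂ) ^ 4 * e4 - (x : ℂ) ^ 2 * e3

theorem integral_haarC1_const (c : ℂ) : ∫ _ : groupC 1, c ∂haarC1 = c := by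
  have h : haarC1 Set.univ = 1 := by
    rw [← TopologicalSpace.PositiveCompacts.coe_top]
    exact MeasureTheory.Measure.haarMeasure_self
  simp [MeasureTheory.Measure.real, h]

theorem integral_prod_det {n : ℕ} (hn : n ∈ ({1, 2, 3, 4, 6} : Finset ℕ)) {m : ℕ}
    (x : Fin m → ℂˣ) :
    ∫ γ : groupC 1, ∏ i : Fin m,
        (1 + (x i : ℂ) • USp4.toMatrix (matJ * zeta n * (γ : USp4))).det ∂haarC1 =
      (∏ i : Fin m, (x i : ℂ)) ^ 2 *
        ∏ i : Fin m, ((x i : ℂ) ^ 2 + (kappa n : ℂ) + (x i : ℂ) ^ (-2 : ℤ)) := by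
  simp_rw [det_one_add_smul_matJ_mul_zeta hn, Finset.prod_mul_distrib, Finset.prod_pow]
  exact integral_haarC1_const _

/-! ### Alternants as minors of the evaluation matrix -/

/-- Transposing and reversing the order puts the degrees in increasing order along the columns, as
in the Laplace expansion. The sign and the product do not depend on `lam`, so they are common to all
terms. -/
theorem sympAlternant_eq_sign_mul_det {m : ℕ} (lam : Fin m → ℕ) :
    sympAlternant lam = ((Equiv.Perm.sign (Fin.revPerm : Equiv.Perm (Fin m)) : ℤ) : LaurentRing m) *
      (∏ j : Fin m, (laurentVar j 1 - laurentVar j (-1))) *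
      (Matrix.of fun i j : Fin m => (sympPoly (LaurentRing m) (lam j.rev + j)).eval
        (laurentVar i 1 + laurentVar i (-1))).det := by
  rw [sympAlternant_eq, mul_comm ((_ : ℤ) : LaurentRing m), mul_assoc]
  congr 1
  rw [← Matrix.det_transpose, ← Matrix.det_permute']
  congr 1
  ext1 i j
  simp only [Matrix.transpose_apply, Matrix.of_apply, Matrix.submatrix_apply, id,
    Fin.revPerm_apply]
  congr 2
  have := j.isLt
  have := i.isLt
  simp only [Fin.rev_rev, Fin.val_rev]
  omega

theorem sympAlternant_zero_eq_vandermonde {m : ℕ} :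
    sympAlternant (0 : Fin m → ℕ) =
      ((Equiv.Perm.sign (Fin.revPerm : Equiv.Perm (Fin m)) : ℤ) : LaurentRing m) *
      (∏ j : Fin m, (laurentVar j 1 - laurentVar j (-1))) *
      (Matrix.vandermonde fun j : Fin m => (laurentVar j 1 + laurentVar j (-1) :
        LaurentRing m)).det := by
  rw [sympAlternant_eq_sign_mul_det, Matrix.det_eval_matrixOfPolynomials_eq_det_vandermonde _
    (fun i : Fin m => sympPoly (LaurentRing m) i)
    (fun i => (sympPoly_monic_natDegree _ _).2) (fun i => (sympPoly_monic_natDegree _ _).1)]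
  simp

theorem spChar_mul_sympAlternant {m : ℕ} (lam : Fin m → ℕ) :
    spChar lam * sympAlternant (0 : Fin m → ℕ) = sympAlternant lam :=
  (existsUnique_spChar lam).choose_spec.1

/-! ### Pairs of deleted columns and their partitions -/

/-- The position in the double Laplace expansion of the partition `(2 ^ (m - b - 2 z), 1 ^ (2 z))`:
the columns `b` and `b + 2 z + 1` are removed, the even one first. -/
def laplaceIndex (b z : ℕ) : ℕ × ℕ :=
  if Even b then (b, b + 2 * z) else (b + 2 * z + 1, b)

/-- A sum over pairs of columns supported on pairs of opposite parity, the first one even. -/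
theorem sum_sum_eq_sum_laplaceIndex {A : Type*} [AddCommMonoid A] (m : ℕ) (F : ℕ → ℕ → A)
    (hF : ∀ k l, ¬ (Even k ∧ (l < k ↔ Odd l)) → F k l = 0) :
    ∑ k ∈ Finset.range (m + 2), ∑ l ∈ Finset.range (m + 1), F k l =
      ∑ b ∈ Finset.range (m + 1), ∑ z ∈ Finset.range ((m - b) / 2 + 1),
        F (laplaceIndex b z).1 (laplaceIndex b z).2 := by
  rw [← Finset.sum_product' (f := F), Finset.sum_sigma']
  symm
  refine Finset.sum_of_injOn (fun a : (_ : ℕ) × ℕ => laplaceIndex a.1 a.2) ?_ ?_ ?_ ?_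
  · rintro ⟨b, z⟩ _ ⟨b', z'⟩ _ h
    simp only [laplaceIndex] at h
    have : b = b' ∧ z = z' := by
      split_ifs at h with h1 h2 h2 <;> rw [Prod.mk.injEq] at h <;>
        rw [Nat.even_iff] at h1 h2 <;> omega
    rw [this.1, this.2]
  · rintro ⟨b, z⟩ h
    simp only [Finset.coe_sigma, Set.mem_sigma_iff, Finset.mem_coe, Finset.mem_range] at h
    simp only [laplaceIndex, Finset.coe_product, Set.mem_prod, Finset.mem_coe, Finset.mem_range]
    split_ifs <;> simp only <;> omega
  · rintro ⟨k, l⟩ h h'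
    simp only [Finset.mem_product, Finset.mem_range] at h
    by_contra hne
    have hkl : Even k ∧ (l < k ↔ Odd l) := by
      by_contra hc
      exact hne (hF k l hc)
    apply h'
    rw [Nat.even_iff, Nat.odd_iff] at hkl
    -- The deleted columns are `k` and `skip k l`, and `b` is the smaller one: the odd column `l` if
    -- `l < k`, and the even column `k` otherwise.
    by_cases hlk : l < k
    · refine ⟨⟨l, (k - l - 1) / 2⟩, ?_, ?_⟩
      · simp only [Finset.coe_sigma, Set.mem_sigma_iff, Finset.mem_coe, Finset.mem_range]
        omega
      · have : ¬ Even l := by rw [Nat.even_iff]; omega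
        simp only [laplaceIndex, if_neg this, Prod.mk.injEq, and_true]
        omega
    · refine ⟨⟨k, (l - k) / 2⟩, ?_, ?_⟩
      · simp only [Finset.coe_sigma, Set.mem_sigma_iff, Finset.mem_coe, Finset.mem_range]
        omega
      · have : Even k := by rw [Nat.even_iff]; omega
        simp only [laplaceIndex, if_pos this, Prod.mk.injEq, true_and]
        omega
  · intro _ _; rfl

/-- The natural-number version of `Fin.succAbove`. -/
def skip (k l : ℕ) : ℕ := if l < k then l else l + 1

theorem val_succAbove_eq_skip {n : ℕ} (k : Fin (n + 1)) (l : Fin n) :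
    (k.succAbove l : ℕ) = skip k l := by
  simp only [skip, Fin.succAbove, Fin.lt_def, Fin.val_castSucc]
  split_ifs <;> rfl

/-- Once columns `b` and `b + 2z + 1` are deleted from `0, …, m + 1`, the first `b` degrees are not
shifted, the next `2z` are shifted by `1`, and the last `m - b - 2z` by `2`. These shifts are the
parts in increasing order. -/
theorem skip_laplaceIndex_eq {m b z : ℕ} (hb : b ≤ m) (hz : z ≤ (m - b) / 2) (j : Fin m) :
    skip (laplaceIndex b z).1 (skip (laplaceIndex b z).2 j) =
      twoOnePartition m (m - b - 2 * z) (2 * z) j.rev + j := by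
  have := j.isLt
  simp only [skip, laplaceIndex, twoOnePartition, Fin.val_rev]
  split_ifs <;> simp only at * <;> omega

section Coefficient

variable (R : Type*) [CommRing R] [Nontrivial R] (κ : ℤ)

/-- The even column supplies the constant coefficient and the odd one the linear coefficient; the
Laplace sign is `+1` for even `b` and `-1` for odd `b`. -/
theorem remCoeff_mul_remCoeff_laplaceIndex (b z : ℕ) :
    (-1) ^ ((laplaceIndex b z).1 + (laplaceIndex b z).2) *
      remCoeff (kappaPoly R κ) 0 (sympPoly R (laplaceIndex b z).1) *
      remCoeff (kappaPoly R κ) 1 (sympPoly R (skip (laplaceIndex b z).1 (laplaceIndex b z).2)) =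
      (rectCoeff κ z b : R) := by
  rcases Nat.even_or_odd' b with ⟨c, rfl | rfl⟩
  · simp only [laplaceIndex, rectCoeff, even_two_mul, if_true, skip]
    rw [if_neg (by omega), Nat.mul_div_cancel_left c two_pos, ← mul_add 2 c z,
      (remCoeff_sympPoly_even R κ c).1, (remCoeff_sympPoly_odd R κ (c + z)).2, ← mul_add 2 c,
      pow_mul]
    push_cast; simp
  · have h : ¬ Even (2 * c + 1) := by simp
    simp only [laplaceIndex, rectCoeff, if_neg h, skip]
    rw [if_pos (by omega), show (2 * c + 1) / 2 = c by omega,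
      show 2 * c + 1 + 2 * z + 1 = 2 * (c + z + 1) by ring,
      (remCoeff_sympPoly_even R κ (c + z + 1)).1, (remCoeff_sympPoly_odd R κ c).2, ← add_assoc,
      ← mul_add 2 _ c, pow_succ, pow_mul]
    push_cast; simp [mul_comm]

theorem remCoeff_mul_remCoeff_eq_zero (k l : ℕ) (h : ¬ (Even k ∧ (l < k ↔ Odd l))) :
    remCoeff (kappaPoly R κ) 0 (sympPoly R k) *
      remCoeff (kappaPoly R κ) 1 (sympPoly R (skip k l)) = 0 := by
  rcases Nat.even_or_odd' k with ⟨c, rfl | rfl⟩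
  · have : Even (skip (2 * c) l) := by
      simp only [Nat.even_iff, Nat.odd_iff, skip] at h ⊢
      split_ifs <;> omega
    obtain ⟨d, hd⟩ := this.two_dvd
    rw [hd, (remCoeff_sympPoly_even R κ d).2, mul_zero]
  · rw [(remCoeff_sympPoly_odd R κ c).1, zero_mul]

end Coefficient

/-! ### The character expansion and the theorem -/

theorem eval_kappaPoly_laurent {m : ℕ} (κ : ℤ) (j : Fin m) :
    (kappaPoly (LaurentRing m) κ).eval (laurentVar j 1 + laurentVar j (-1)) =
      laurentVar j 2 + (κ : LaurentRing m) + laurentVar j (-2) := by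
  have h1 : (laurentVar j 1 * laurentVar j (-1) : LaurentRing m) = 1 := by
    rw [laurentVar_mul, add_neg_cancel, laurentVar_zero]
  have h2 : (laurentVar j 1 ^ 2 : LaurentRing m) = laurentVar j 2 := by
    rw [laurentVar_pow]; rfl
  have h3 : (laurentVar j (-1) ^ 2 : LaurentRing m) = laurentVar j (-2) := by
    rw [laurentVar_pow]; rfl
  simp only [kappaPoly, Polynomial.eval_add, Polynomial.eval_pow, Polynomial.eval_X,
    Polynomial.eval_C, Int.cast_sub, Int.cast_ofNat]
  linear_combination 2 * h1 + h2 + h3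

/-- The expansion of `∏ (x_j ^ 2 + κ + x_j ^ (-2))` into symplectic characters. -/
theorem prod_eq_sum_rectCoeff_mul_spChar (m : ℕ) (κ : ℤ) :
    ∏ j : Fin m, (laurentVar j 2 + (κ : LaurentRing m) + laurentVar j (-2)) =
      ∑ b ∈ Finset.range (m + 1), ∑ z ∈ Finset.range ((m - b) / 2 + 1),
        (rectCoeff κ z b : LaurentRing m) *
          spChar (twoOnePartition m (m - b - 2 * z) (2 * z)) := by
  have : IsDomain (LaurentRing m) := NoZeroDivisors.to_isDomain _
  -- Multiplying by the Weyl denominator turns characters into alternants; it can be cancelled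
  -- because the Laurent ring is a domain.
  apply mul_right_cancel₀ (sympAlternant_zero_ne_zero m)
  set f := kappaPoly (LaurentRing m) κ
  set P := sympPoly (LaurentRing m)
  set y : Fin m → LaurentRing m := fun i => laurentVar i 1 + laurentVar i (-1)
  have key := prod_quadratic_mul_vandermonde f (kappaPoly_monic _ κ) (kappaPoly_natDegree _ κ)
    P (fun i => (sympPoly_monic_natDegree _ i).2) (fun i => (sympPoly_monic_natDegree _ i).1) y
  simp only [val_succAbove_eq_skip] at key
  set F : ℕ → ℕ → LaurentRing m := fun k l => (-1) ^ (k + l) * remCoeff f 0 (P k) *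
    remCoeff f 1 (P (skip k l)) * (Matrix.of fun i j : Fin m => (P (skip k (skip l j))).eval
      (y i)).det with hF
  -- Sums over `Fin` become sums over ranges, so that the surviving pairs can be reindexed by `(b,
  -- z)`.
  rw [show ∑ k : Fin (m + 2), ∑ l : Fin (m + 1), _ = ∑ k : Fin (m + 2), ∑ l : Fin (m + 1),
    F k l from rfl, Fin.sum_univ_eq_sum_range (fun k => ∑ l : Fin (m + 1), F k l),
    Finset.sum_congr rfl (fun k _ => Fin.sum_univ_eq_sum_range (F k) (m + 1)),
    sum_sum_eq_sum_laplaceIndex m F fun k l h => by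
      simp only [hF]
      rw [mul_assoc ((-1) ^ (k + l)), remCoeff_mul_remCoeff_eq_zero _ κ k l h]; simp] at key
  simp only [← eval_kappaPoly_laurent]
  rw [sympAlternant_zero_eq_vandermonde, mul_left_comm, key, ← sympAlternant_zero_eq_vandermonde,
    Finset.mul_sum, Finset.sum_mul]
  refine Finset.sum_congr rfl fun b hb => ?_
  rw [Finset.mul_sum, Finset.sum_mul]
  refine Finset.sum_congr rfl fun z hz => ?_
  rw [Finset.mem_range] at hb hz
  rw [mul_assoc _ (spChar _), spChar_mul_sympAlternant, sympAlternant_eq_sign_mul_det,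
    ← remCoeff_mul_remCoeff_laplaceIndex]
  simp only [← skip_laplaceIndex_eq (Nat.lt_succ_iff.1 hb) (Nat.lt_succ_iff.1 hz), hF]
  ring

theorem laurentEval_laurentVar {m : ℕ} (x : Fin m → ℂˣ) (j : Fin m) (k : ℤ) :
    laurentEval x (laurentVar j k) = (x j : ℂ) ^ k := by
  rw [laurentEval, laurentVar, AddMonoidAlgebra.lift_single]
  simp only [MonoidHom.coe_mk, OneHom.coe_mk, toAdd_ofAdd, one_smul]
  rw [Finset.prod_eq_single j]
  · simp
  · intro i _ hi
    simp [hi]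
  · simp

theorem theorem1p2 (n : ℕ) (hn : n ∈ ({1, 2, 3, 4, 6} : Finset ℕ)) :
    (∀ z b : ℕ, ∃ k : ℤ, psiCoeff n z b = k) ∧
    ∀ m : ℕ, 1 ≤ m → ∀ x : Fin m → ℂˣ,
      (∫ γ : groupC 1, ∏ i : Fin m,
          (1 + (x i : ℂ) • USp4.toMatrix (matJ * zeta n * (γ : USp4))).det ∂haarC1
        = (∏ i : Fin m, (x i : ℂ)) ^ 2 *
          ∏ i : Fin m, ((x i : ℂ) ^ 2 + (kappa n : ℂ) + (x i : ℂ) ^ (-2 : ℤ))) ∧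
      (∏ i : Fin m, ((x i : ℂ) ^ 2 + (kappa n : ℂ) + (x i : ℂ) ^ (-2 : ℤ))
        = ∑ b ∈ Finset.range (m + 1), ∑ z ∈ Finset.range ((m - b) / 2 + 1),
            (psiCoeff n z b : ℂ) *
              laurentEval x (spChar (twoOnePartition m (m - b - 2 * z) (2 * z)))) 
 := by
  refine ⟨fun z b => ⟨rectCoeff (kappa n) z b, psiCoeff_eq_rectCoeff hn z b⟩,
    fun m _ x => ⟨integral_prod_det hn x, ?_⟩⟩
  have h := congrArg (laurentEval x) (prod_eq_sum_rectCoeff_mul_spChar m (kappa n))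
  simp only [map_prod, map_sum, map_add, map_mul, map_intCast, laurentEval_laurentVar] at h
  simpa only [psiCoeff_eq_rectCoeff hn, Rat.cast_intCast, zpow_ofNat] using h
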